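/- For real $s$ let $$\widetilde W(s)=\iiint_{[0,1]^3}\bigl|1+e^{2\pi i\theta_1}+e^{2\pi i\theta_2}+e^{2\pi i\theta_3}+e^{2\pi i(\theta_2+\theta_3)}\bigr|^s\,d\theta_1\,d\theta_2\,d\theta_3 ,$$ and write $$F(z)={}_2F_1\Bigl(\tfrac12,\tfrac12;1;z\Bigr)=\sum_{n\ge0}\frac{(1/2)_n^2}{n!^2}\,z^n .$$ Then $\widetilde W(2n)=\sum_{k=0}^n\binom nk^2\binom{2k}k^2$ for all integers $n\ge0$, and for all complex $t$ in some neighbourhood of $0$ the following series converges and $$\sum_{n=0}^\infty\widetilde W(2n)\Bigl(\frac t{(4+t)(1+4t)}\Bigr)^n =\frac{(4+t)(1+4t)}{4(1+4t+t^2)}\,F\Bigl(\frac{t(4+t)}{1+4t+t^2}\Bigr)F\Bigl(\frac{t^2}{1+4t+t^2}\Bigr).$$ More generally, for every complex $b\ne0$ and all complex $t$ in some neighbourhood of $0$ (depending on $b$), the following series converges and $$\begin{aligned} \frac b{(b+t)(1+bt)}\sum_{n=0}^\infty\Bigl(\frac t{(b+t)(1+bt)}\Bigr)^n\sum_{k=0}^n\binom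 nk^2\binom{2k}k^2\Bigl(\frac b4\Bigr)^{2k} &=F\bigl(-t(b+t)\bigr)\cdot\frac1{(1+bt)^{1/2}}\,F\Bigl(-\frac{t^2}{1+bt}\Bigr)\\ &=\frac1{1+bt+t^2}\,F\Bigl(\frac{t(b+t)}{1+bt+t^2}\Bigr)F\Bigl(\frac{t^2}{1+bt+t^2}\Bigr), \end{aligned}$$ where $(1+bt)^{1/2}$ is the principal branch. -/

import Mathlib

open Filter Topology

/-- The point `e^{2πiθ}` of the unit circle. -/
noncomputable def unitStep (θ : ℝ) : ℂ :=
  Complex.exp (2 * Real.pi * Complex.I * θ)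

/-- The `s`-th moment of the distance to the origin of the random five-step walk
`1 + e^{2πiθ₁} + e^{2πiθ₂} + e^{2πiθ₃} + e^{2πi(θ₂+θ₃)}` with `θ₁, θ₂, θ₃` independent and uniform
on `[0,1]`, i.e. the zeta Mahler measure of `1 + x₁ + x₂ + x₃ + x₂x₃` at `s`. -/
noncomputable def walkMoment (s : ℝ) : ℝ :=
  ∫ θ₁ in (0 : ℝ)..1, ∫ θ₂ in (0 : ℝ)..1, ∫ θ₃ in (0 : ℝ)..1,
    ‖1 + unitStep θ₁ + unitStep θ₂ + unitStep θ₃ + unitStep (θ₂ + θ₃)‖ ^ s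

/-- The function `₂F₁(1/2, 1/2; 1; z)`, as the sum of its hypergeometric series. -/
noncomputable def hypHalf (z : ℂ) : ℂ :=
  ordinaryHypergeometric (1 / 2 : ℂ) (1 / 2 : ℂ) (1 : ℂ) z

/-- The sum `∑_{k=0}^n C(n,k)² C(2k,k)² (b/4)^{2k}`. -/
noncomputable def twistedSum (b : ℂ) (n : ℕ) : ℂ :=
  ∑ k ∈ Finset.range (n + 1),
    (n.choose k : ℂ) ^ 2 * ((2 * k).choose k : ℂ) ^ 2 * (b / 4) ^ (2 * k)

/-! Write a_k = (1/2)_k / k!, so that F(z) = ∑ a_k² z^k and C(2k,k)² (b/4)^{2k} = a_k² b^{2k}.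

Moments: since 1 + y + z + yz = (1 + y)(1 + z), the walk is a unit step from w = (1 + y)(1 + z).
Orthogonality of characters gives ∑ C(n,k)² |w|^{2k} for its 2n-th moment, and each factor of w
contributes C(2k,k).

Generating function: summing over n first, ∑ C(n,k)² x^n = x^k (1-x)^{-2k-1} ∑_j C(k,j)² x^j
(`hasSum_choose_sq_mul_pow`). The sum over k is then (1-x)^{-1} F₄(1/2,1/2;1,1; u, ux) with u =
b²x/(1-x)². Bailey's reduction F₄(X(1-Y), Y(1-X)) = F(X)F(Y) (`hasSum_appell`) applies once X(1-Y) =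
u and Y(1-X) = ux. For x = t/((b+t)(1+bt)) and D = 1+bt+t² this is solved by X = t(b+t)/D, Y = t²/D.

Second product form: Pfaff's transformation (`hypHalf_pfaff`) applied to both factors. The moment
series is the case b = 4. -/

/-! ### The coefficients (1/2)_n / n! and Pfaff's transformation. -/

/-- The coefficient `(1/2)ₙ / n!` of `(1 - z)^(-1/2)`. -/
noncomputable def halfCoeff (n : ℕ) : ℂ := (n.centralBinom : ℂ) / 4 ^ n

lemma halfCoeff_zero : halfCoeff 0 = 1 := by simp [halfCoeff]

lemma halfCoeff_succ (n : ℕ) :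
    (n + 1 : ℂ) * halfCoeff (n + 1) = (n + 1 / 2) * halfCoeff n := by
  have h : ((n + 1 : ℕ) : ℂ) * ((n + 1).centralBinom : ℂ) = 2 * (2 * n + 1) * n.centralBinom := by
    exact_mod_cast Nat.succ_mul_centralBinom_succ n
  push_cast at h
  unfold halfCoeff
  rw [pow_succ]
  field_simp
  linear_combination 2 * h

lemma norm_halfCoeff_le_one (n : ℕ) : ‖halfCoeff n‖ ≤ 1 := by
  have h : (n.centralBinom : ℝ) ≤ 4 ^ n := by
    have h2 : n.centralBinom ≤ 2 ^ (2 * n) := by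
      rw [Nat.centralBinom]; exact Nat.choose_le_two_pow _ _
    rw [pow_mul] at h2
    exact_mod_cast h2
  rw [halfCoeff, norm_div, norm_pow, Complex.norm_natCast]
  norm_num
  rw [div_le_one (by positivity)]
  exact h

lemma ascPochhammer_half_eval (n : ℕ) :
    (ascPochhammer ℂ n).eval (1 / 2 : ℂ) = n.factorial * halfCoeff n := by
  induction n with
  | zero => simp [halfCoeff_zero]
  | succ n ih =>
    rw [ascPochhammer_succ_eval, ih, Nat.factorial_succ]
    push_cast
    linear_combination -(n.factorial : ℂ) * halfCoeff_succ n

lemma hypHalf_eq_tsum (z : ℂ) : hypHalf z = ∑' n : ℕ, halfCoeff n ^ 2 * z ^ n := by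
  rw [hypHalf, ordinaryHypergeometric_eq_tsum]
  refine tsum_congr fun n => ?_
  have h : (n.factorial : ℂ) ≠ 0 := by exact_mod_cast n.factorial_ne_zero
  rw [ascPochhammer_half_eval, ascPochhammer_eval_one, smul_eq_mul]
  field_simp

lemma summable_hypHalf_norm {z : ℂ} (hz : ‖z‖ < 1) :
    Summable fun n : ℕ => ‖halfCoeff n ^ 2 * z ^ n‖ := by
  refine Summable.of_nonneg_of_le (fun _ => norm_nonneg _) (fun n => ?_)
    (summable_geometric_of_lt_one (norm_nonneg z) hz)
  rw [norm_mul, norm_pow, norm_pow]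
  exact mul_le_of_le_one_left (by positivity) (pow_le_one₀ (norm_nonneg _) (norm_halfCoeff_le_one n))

lemma hasSum_hypHalf {z : ℂ} (hz : ‖z‖ < 1) :
    HasSum (fun n : ℕ => halfCoeff n ^ 2 * z ^ n) (hypHalf z) := by
  rw [hypHalf_eq_tsum]
  exact (summable_hypHalf_norm hz).of_norm.hasSum

lemma HasSum.sum_antidiagonal {f : ℕ × ℕ → ℂ} {s : ℂ} (hf : HasSum f s) :
    HasSum (fun n => ∑ p ∈ Finset.HasAntidiagonal.antidiagonal n, f p) s := by
  have h := (Finset.HasAntidiagonal.sigmaAntidiagonalEquivProd (A := ℕ)).hasSum_iff.mpr hf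
  refine h.sigma fun n => ?_
  have := Finset.hasSum (Finset.HasAntidiagonal.antidiagonal n) f
  exact this

/-- The sequence `(1/2)ₙ / n!` is invariant under the binomial transform. -/
lemma sum_choose_mul_halfCoeff (n : ℕ) :
    ∑ k ∈ Finset.range (n + 1), (-1 : ℂ) ^ k * n.choose k * halfCoeff k = halfCoeff n := by
  induction n with
  | zero => simp
  | succ n ih =>
    set S := ∑ k ∈ Finset.range (n + 1), (-1 : ℂ) ^ k * n.choose k * halfCoeff k with hS
    have ext1 : ∑ k ∈ Finset.range (n + 2), (-1 : ℂ) ^ k * n.choose k * halfCoeff k = S := by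
      rw [Finset.sum_range_succ]; simp [hS]
    have pascal : ∑ k ∈ Finset.range (n + 1 + 1), (-1 : ℂ) ^ k * (n + 1).choose k * halfCoeff k =
        S - ∑ k ∈ Finset.range (n + 1), (-1 : ℂ) ^ k * n.choose k * halfCoeff (k + 1) := by
      rw [← ext1, Finset.sum_range_succ', Finset.sum_range_succ' _ (n + 1), add_sub_right_comm,
        ← Finset.sum_sub_distrib]
      congr 1
      · refine Finset.sum_congr rfl fun k _ => ?_
        rw [Nat.choose_succ_succ]; push_cast; ring
      · simp
    -- Creative telescoping with certificate (-1)^k k a_k C(n,k), which vanishes at k = 0 and k = n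
    -- + 1; it yields (n+1) S_{n+1} = (n+1/2) S_n, the recurrence of a_n.
    have tele : ∑ k ∈ Finset.range (n + 1),
        ((-1 : ℂ) ^ (k + 1) * (k + 1 : ℕ) * halfCoeff (k + 1) * n.choose (k + 1) -
          (-1 : ℂ) ^ k * (k : ℕ) * halfCoeff k * n.choose k) = 0 := by
      rw [Finset.sum_range_sub (fun k => (-1 : ℂ) ^ k * (k : ℕ) * halfCoeff k * n.choose k)]
      simp
    have key : (n + 1 : ℂ) * (S - ∑ k ∈ Finset.range (n + 1),
        (-1 : ℂ) ^ k * n.choose k * halfCoeff (k + 1)) - (n + 1 / 2) * S = 0 := by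
      rw [← tele, hS, mul_sub, Finset.mul_sum, Finset.mul_sum, Finset.mul_sum,
        ← Finset.sum_sub_distrib, ← Finset.sum_sub_distrib]
      refine Finset.sum_congr rfl fun k hk => ?_
      have hk' : k ≤ n := Nat.lt_succ_iff.mp (Finset.mem_range.mp hk)
      have h1 := halfCoeff_succ k
      have h2 : (n.choose (k + 1) : ℂ) * (k + 1) = n.choose k * (n - k) := by
        have := Nat.choose_succ_right_eq n k
        rw [← Nat.cast_sub hk']
        exact_mod_cast this
      have h3 : (k + 1 : ℂ) ≠ 0 := by exact_mod_cast k.succ_ne_zero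
      apply mul_left_cancel₀ h3
      rw [pow_succ]
      push_cast
      linear_combination (-1 : ℂ) ^ k * ((k + 1) * halfCoeff (k + 1) * h2
        - (k + 1) * n.choose k * h1)
    rw [pascal]
    have h3 : (n + 1 : ℂ) ≠ 0 := by exact_mod_cast n.succ_ne_zero
    apply mul_left_cancel₀ h3
    linear_combination key - halfCoeff_succ n + (n + 1 / 2) * ih

/-- Both sides equal (1/2)_{k+n} / (k! n!). The `Ring.choose` factor is the n-th Taylor coefficient
of (1-z)^{-(k+1/2)}. -/
lemma halfCoeff_mul_choose (k n : ℕ) :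
    halfCoeff k * Ring.choose ((k + 1 / 2 : ℂ) + n - 1) n = halfCoeff (k + n) * (k + n).choose k := by
  rw [← Ring.multichoose_eq]
  have hf : (n.factorial : ℂ) ≠ 0 := by exact_mod_cast n.factorial_ne_zero
  have h0 : (n.factorial : ℂ) * Ring.multichoose (k + 1 / 2 : ℂ) n =
      (ascPochhammer ℂ n).eval (k + 1 / 2 : ℂ) := by
    have := Ring.factorial_nsmul_multichoose_eq_ascPochhammer (k + 1 / 2 : ℂ) n
    rw [nsmul_eq_mul] at this
    rw [this, Polynomial.ascPochhammer_smeval_cast, Polynomial.ascPochhammer_smeval_eq_eval]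
  have h1 : ∀ n : ℕ, (k.factorial : ℂ) * (halfCoeff k * (ascPochhammer ℂ n).eval (k + 1 / 2 : ℂ)) =
      (k + n).factorial * halfCoeff (k + n) := by
    intro n
    induction n with
    | zero => simp
    | succ n ih =>
      rw [ascPochhammer_succ_eval, ← add_assoc, Nat.factorial_succ]
      have := halfCoeff_succ (k + n)
      push_cast at this ⊢
      linear_combination (k + 1 / 2 + n : ℂ) * ih - (k + n).factorial * this
  have hk : (k.factorial : ℂ) ≠ 0 := by exact_mod_cast k.factorial_ne_zero
  have h2 : ((k + n).choose k : ℂ) * k.factorial * n.factorial = (k + n).factorial := by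
    rw [Nat.choose_symm_add]; exact_mod_cast Nat.add_choose_mul_factorial_mul_factorial k n
  apply mul_left_cancel₀ (mul_ne_zero hk hf)
  linear_combination k.factorial * halfCoeff k * h0 + h1 n - halfCoeff (k + n) * h2

/-- Pfaff's transformation of `₂F₁(1/2, 1/2; 1; z)`. -/
lemma hypHalf_pfaff {z : ℂ} (hz : ‖z‖ < 1 / 3) :
    hypHalf (z / (z - 1)) = (1 - z) ^ (1 / 2 : ℂ) * hypHalf z := by
  have hz1 : ‖z‖ < 1 := by linarith
  have hne : 1 - z ≠ 0 := by
    intro h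
    have : z = 1 := by linear_combination -h
    rw [this] at hz1; simp at hz1
  -- Row k sums to the k-th term of (1-z)^{-1/2} F(z/(z-1)); the antidiagonal of index n sums to
  -- a_n² z^n by the binomial transform. The majorant is a product of two geometric series of ratio
  -- 2‖z‖ < 1.
  set f : ℕ × ℕ → ℂ := fun p => (-1) ^ p.1 * halfCoeff p.1 *
    (halfCoeff (p.1 + p.2) * (p.1 + p.2).choose p.1) * z ^ (p.1 + p.2) with hf
  have hsum : Summable f := by
    have hg : Summable fun n : ℕ => (2 * ‖z‖) ^ n :=
      summable_geometric_of_lt_one (by positivity) (by linarith)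
    refine Summable.of_norm_bounded (hg.mul_of_nonneg hg (fun n => by positivity)
      (fun n => by positivity)) fun p => ?_
    have h1 := norm_halfCoeff_le_one p.1
    have h2 := norm_halfCoeff_le_one (p.1 + p.2)
    have h3 : ((p.1 + p.2).choose p.1 : ℝ) ≤ 2 ^ (p.1 + p.2) := by
      exact_mod_cast Nat.choose_le_two_pow _ _
    simp only [hf, norm_mul, norm_pow, norm_neg, norm_one, one_pow, one_mul,
      Complex.norm_natCast]
    calc _ ≤ 1 * (1 * 2 ^ (p.1 + p.2)) * ‖z‖ ^ (p.1 + p.2) := by gcongr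
      _ = _ := by rw [pow_add, pow_add, mul_pow, mul_pow]; ring
  obtain ⟨s, hs⟩ := hsum
  have hdiag : s = hypHalf z := by
    refine hs.sum_antidiagonal.unique ?_
    convert hasSum_hypHalf hz1 using 2 with n
    rw [Finset.Nat.sum_antidiagonal_eq_sum_range_succ_mk, sq]
    conv_rhs =>
      enter [1, 1]
      rw [← sum_choose_mul_halfCoeff n]
    rw [Finset.sum_mul, Finset.sum_mul]
    refine Finset.sum_congr rfl fun k hk => ?_
    have hk' : k ≤ n := Nat.lt_succ_iff.mp (Finset.mem_range.mp hk)
    simp only [hf, Nat.add_sub_cancel' hk']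
    ring
  have hrow : ∀ k, HasSum (fun j => f (k, j))
      (halfCoeff k ^ 2 * (z / (z - 1)) ^ k * (1 / (1 - z) ^ (1 / 2 : ℂ))) := by
    intro k
    have h := (Complex.one_div_one_sub_cpow_hasFPowerSeriesOnBall_zero (k + 1 / 2 : ℂ)).hasSum
      (y := z) (by simpa [← ofReal_norm, ← ENNReal.ofReal_one] using hz1)
    have h' := h.mul_left ((-1) ^ k * halfCoeff k ^ 2 * z ^ k)
    convert! h' using 1
    · funext j
      simp only [hf, FormalMultilinearSeries.ofScalars_apply_eq, smul_eq_mul]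
      rw [← halfCoeff_mul_choose, pow_add]
      ring
    · rw [zero_add, Complex.cpow_add _ _ hne, Complex.cpow_natCast,
        show z / (z - 1) = -1 * z * (1 - z)⁻¹ by
          rw [← neg_sub 1 z, div_neg, div_eq_mul_inv]; ring, mul_pow, mul_pow]
      rw [inv_pow]
      field_simp
  have hrows := hs.prod_fiberwise hrow
  have hcp : (1 - z) ^ (1 / 2 : ℂ) ≠ 0 := by simp [Complex.cpow_eq_zero_iff, hne]
  have hrows' := (hrows.mul_right ((1 - z) ^ (1 / 2 : ℂ))).tsum_eq
  rw [hypHalf_eq_tsum, ← hdiag, mul_comm, ← hrows']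
  refine tsum_congr fun k => ?_
  field_simp

/-! ### Bailey's reduction of Appell's F₄. -/

/-- The coefficient of `x ^ i` in `x ^ m * (1 + ε * x) ^ n`. -/
noncomputable def shiftedBinomCoeff {K : Type*} [CommRing K] (ε : K) (m n i : ℕ) : K :=
  if m ≤ i then ε ^ (i - m) * n.choose (i - m) else 0

lemma shiftedBinomCoeff_add {K : Type*} [CommRing K] (ε : K) (m n p : ℕ) :
    shiftedBinomCoeff ε m n (m + p) = ε ^ p * n.choose p := by
  simp [shiftedBinomCoeff]

lemma shiftedBinomCoeff_of_lt {K : Type*} [CommRing K] (ε : K) {m n i : ℕ} (h : i < m) :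
    shiftedBinomCoeff ε m n i = 0 := by
  simp [shiftedBinomCoeff, h]

lemma hasSum_shiftedBinomCoeff {K : Type*} [CommRing K] [TopologicalSpace K] (ε x : K) (m n : ℕ) :
    HasSum (fun i => shiftedBinomCoeff ε m n i * x ^ i) (x ^ m * (1 + ε * x) ^ n) := by
  rw [← Function.Injective.hasSum_iff (add_right_injective m)]
  · have h : x ^ m * (1 + ε * x) ^ n = ∑ p ∈ Finset.range (n + 1),
        ((fun i => shiftedBinomCoeff ε m n i * x ^ i) ∘ fun p => m + p) p := by
      rw [add_comm 1, add_pow, Finset.mul_sum]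
      refine Finset.sum_congr rfl fun p _ => ?_
      simp only [Function.comp_apply, shiftedBinomCoeff_add, mul_pow, one_pow, pow_add]
      ring
    rw [h]
    refine hasSum_sum_of_ne_finset_zero fun p hp => ?_
    have hp' : n < p := by simpa using hp
    simp [shiftedBinomCoeff_add, Nat.choose_eq_zero_of_lt hp']
  · intro i hi
    rw [shiftedBinomCoeff_of_lt, zero_mul]
    by_contra h
    exact hi ⟨i - m, by simp; omega⟩

/-- The choice ε = 1 supplies the majorant series for ε = -1. -/
lemma norm_shiftedBinomCoeff (m n i : ℕ) :
    ‖shiftedBinomCoeff (-1 : ℂ) m n i‖ = shiftedBinomCoeff (1 : ℝ) m n i := by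
  unfold shiftedBinomCoeff
  split_ifs <;> simp

lemma summable_norm_shiftedBinomCoeff (x : ℂ) (m n : ℕ) :
    Summable fun i => ‖shiftedBinomCoeff (-1 : ℂ) m n i * x ^ i‖ := by
  simpa only [norm_mul, norm_pow, norm_shiftedBinomCoeff] using
    (hasSum_shiftedBinomCoeff (1 : ℝ) ‖x‖ m n).summable

/-- Coefficient form of y^n (1-y)^m ((1-y) + y) = y^n (1-y)^m. -/
lemma shiftedBinomCoeff_pascal (m n j : ℕ) :
    shiftedBinomCoeff (-1 : ℂ) n (m + 1) j + shiftedBinomCoeff (-1 : ℂ) (n + 1) m j =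
      shiftedBinomCoeff (-1 : ℂ) n m j := by
  rcases lt_or_ge j n with h | h
  · rw [shiftedBinomCoeff_of_lt _ h, shiftedBinomCoeff_of_lt _ h,
      shiftedBinomCoeff_of_lt _ (by omega), add_zero]
  · obtain ⟨p, rfl⟩ := Nat.exists_eq_add_of_le h
    cases p with
    | zero =>
      rw [shiftedBinomCoeff_add, shiftedBinomCoeff_add, shiftedBinomCoeff_of_lt _ (by omega)]
      simp
    | succ p =>
      rw [shiftedBinomCoeff_add, shiftedBinomCoeff_add, show n + (p + 1) = n + 1 + p by ring,
        shiftedBinomCoeff_add, Nat.choose_succ_succ]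
      push_cast
      ring

/-- The hypergeometric differential operator applied to `x ^ m * (1 - x) ^ n`, on coefficients. -/
lemma shiftedBinomCoeff_hypergeometric (m n i : ℕ) :
    (i + 1 : ℂ) ^ 2 * shiftedBinomCoeff (-1) m n (i + 1) -
        (i + 1 / 2) ^ 2 * shiftedBinomCoeff (-1) m n i =
      m ^ 2 * shiftedBinomCoeff (-1) (m - 1) n i + n ^ 2 * shiftedBinomCoeff (-1) m (n - 1) i -
        (m + n + 1 / 2) ^ 2 * shiftedBinomCoeff (-1) m n i := by
  rcases lt_or_ge i m with h | h
  · obtain ⟨m, rfl⟩ : ∃ m', m = m' + 1 := ⟨m - 1, by omega⟩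
    rw [shiftedBinomCoeff_of_lt _ h, shiftedBinomCoeff_of_lt _ h, Nat.add_sub_cancel]
    rcases lt_or_eq_of_le (Nat.lt_succ_iff.mp h) with h' | rfl
    · rw [shiftedBinomCoeff_of_lt _ h', shiftedBinomCoeff_of_lt _ (by omega)]
      ring
    · rw [show shiftedBinomCoeff (-1 : ℂ) (i + 1) n (i + 1) = 1 by simp [shiftedBinomCoeff],
        show shiftedBinomCoeff (-1 : ℂ) i n i = 1 by simp [shiftedBinomCoeff]]
      push_cast
      ring
  · obtain ⟨p, rfl⟩ := Nat.exists_eq_add_of_le h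
    -- At m = 0 the truncated m - 1 is harmless, because its coefficient m² vanishes.
    have e1 : (m : ℂ) ^ 2 * shiftedBinomCoeff (-1) (m - 1) n (m + p) =
        m ^ 2 * ((-1) ^ (p + 1) * n.choose (p + 1)) := by
      rcases Nat.eq_zero_or_pos m with rfl | hm
      · simp
      · rw [show m + p = m - 1 + (p + 1) by omega, shiftedBinomCoeff_add]
    rw [e1, show m + p + 1 = m + (p + 1) by ring, shiftedBinomCoeff_add, shiftedBinomCoeff_add,
      shiftedBinomCoeff_add]
    have e2 : (n.choose (p + 1) : ℂ) * (p + 1) = n.choose p * (n - p) := by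
      rcases lt_or_ge n p with hp | hp
      · simp [Nat.choose_eq_zero_of_lt hp, Nat.choose_eq_zero_of_lt (show n < p + 1 by omega)]
      · rw [← Nat.cast_sub hp]
        exact_mod_cast Nat.choose_succ_right_eq n p
    have e3 : (n : ℂ) * (n - 1).choose p = (n - p) * n.choose p := by
      cases n with
      | zero => cases p <;> simp
      | succ n =>
        have h3 : ((n + 1).choose (p + 1) : ℂ) * (p + 1) = (n + 1) * n.choose p := by
          exact_mod_cast (Nat.add_one_mul_choose_eq n p).symm
        rw [Nat.add_sub_cancel]
        push_cast at e2 h3 ⊢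
        linear_combination e2 - h3
    push_cast
    rw [pow_succ]
    linear_combination -(-1 : ℂ) ^ p * (2 * m + p + 1) * e2 - n * (-1 : ℂ) ^ p * e3

/-- The coefficients of the Appell series `F₄(1/2, 1/2; 1, 1; x, y)`. -/
noncomputable def appellCoeff (m n : ℕ) : ℂ := (halfCoeff (m + n) * (m + n).choose m) ^ 2

lemma appellCoeff_succ_left (m n : ℕ) :
    (m + 1 : ℂ) ^ 2 * appellCoeff (m + 1) n = (m + n + 1 / 2) ^ 2 * appellCoeff m n := by
  have h1 := halfCoeff_succ (m + n)
  have h2 : ((m + n + 1).choose (m + 1) : ℂ) * (m + 1) = (m + n + 1) * (m + n).choose m := by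
    exact_mod_cast (Nat.add_one_mul_choose_eq (m + n) m).symm
  push_cast at h1
  have h3 : (m + 1 : ℂ) * (halfCoeff (m + 1 + n) * (m + 1 + n).choose (m + 1)) =
      (m + n + 1 / 2) * (halfCoeff (m + n) * (m + n).choose m) := by
    rw [show m + 1 + n = m + n + 1 by ring]
    linear_combination halfCoeff (m + n + 1) * h2 + (m + n).choose m * h1
  rw [appellCoeff, appellCoeff, ← mul_pow, ← mul_pow, h3]

lemma appellCoeff_comm (m n : ℕ) : appellCoeff m n = appellCoeff n m := by
  rw [appellCoeff, appellCoeff, add_comm m n, Nat.choose_symm_add]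

lemma appellCoeff_succ_right (m n : ℕ) :
    (n + 1 : ℂ) ^ 2 * appellCoeff m (n + 1) = (m + n + 1 / 2) ^ 2 * appellCoeff m n := by
  rw [appellCoeff_comm, appellCoeff_succ_left, appellCoeff_comm, add_comm (n : ℂ)]

lemma norm_appellCoeff_le (m n : ℕ) : ‖appellCoeff m n‖ ≤ 4 ^ m * 4 ^ n := by
  have h1 := norm_halfCoeff_le_one (m + n)
  have h3 : ((m + n).choose m : ℝ) ≤ 2 ^ (m + n) := by
    exact_mod_cast Nat.choose_le_two_pow _ _
  rw [appellCoeff, norm_pow, norm_mul, Complex.norm_natCast]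
  calc _ ≤ (1 * 2 ^ (m + n) : ℝ) ^ 2 := by gcongr
    _ = _ := by rw [one_mul, ← pow_mul, mul_comm, pow_mul, pow_add]; norm_num

lemma sum_range_eq_of_le {f : ℕ → ℂ} {a b : ℕ} (h : a ≤ b) (hf : ∀ k, a ≤ k → f k = 0) :
    ∑ k ∈ Finset.range b, f k = ∑ k ∈ Finset.range a, f k := by
  symm
  refine Finset.sum_subset (Finset.range_subset_range.mpr h) fun k _ hk => hf k ?_
  simpa using hk

/-- The coefficient of `X ^ i * Y ^ j` in `F₄(1/2, 1/2; 1, 1; X (1 - Y), Y (1 - X))`. -/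
noncomputable def appellProductCoeff (i j : ℕ) : ℂ :=
  ∑ m ∈ Finset.range (i + 1), ∑ n ∈ Finset.range (j + 1),
    appellCoeff m n * (shiftedBinomCoeff (-1) m n i * shiftedBinomCoeff (-1) n m j)

/-- Terms with m > i or n > j vanish, so coefficients of different index can be summed over one
common box. -/
lemma appellProductCoeff_eq {i j M N : ℕ} (hM : i + 1 ≤ M) (hN : j + 1 ≤ N) :
    appellProductCoeff i j = ∑ m ∈ Finset.range M, ∑ n ∈ Finset.range N,
      appellCoeff m n * (shiftedBinomCoeff (-1) m n i * shiftedBinomCoeff (-1) n m j) := by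
  rw [sum_range_eq_of_le hM, appellProductCoeff]
  · refine Finset.sum_congr rfl fun m _ => ?_
    rw [sum_range_eq_of_le hN]
    intro n hn
    rw [shiftedBinomCoeff_of_lt (m := n) _ (by omega)]
    ring
  · intro m hm
    refine Finset.sum_eq_zero fun n _ => ?_
    rw [shiftedBinomCoeff_of_lt (m := m) _ (by omega)]
    ring

/-- The hypergeometric operator in X annihilates the series. It sends X^m (1-X)^n to three such
monomials; shifting m and n by the recurrences of `appellCoeff` gives all three the same X-part, and
their Y-parts cancel by `shiftedBinomCoeff_pascal`. -/
lemma appellProductCoeff_succ (i j : ℕ) :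
    (i + 1 : ℂ) ^ 2 * appellProductCoeff (i + 1) j =
      (i + 1 / 2) ^ 2 * appellProductCoeff i j := by
  set M := i + 1
  set N := j + 1
  set β : ℕ → ℕ → ℂ := fun m n => shiftedBinomCoeff (-1) n m j
  set α : ℕ → ℕ → ℂ := fun m n => shiftedBinomCoeff (-1) m n i
  have hα : ∀ m n, M ≤ m → α m n = 0 := fun m n h => shiftedBinomCoeff_of_lt _ (by omega)
  have hβ : ∀ m n, N ≤ n → β m n = 0 := fun m n h => shiftedBinomCoeff_of_lt _ (by omega)
  have expand : (i + 1 : ℂ) ^ 2 * appellProductCoeff (i + 1) j -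
      (i + 1 / 2) ^ 2 * appellProductCoeff i j =
      ∑ m ∈ Finset.range (M + 1), ∑ n ∈ Finset.range (N + 1),
        ((m : ℂ) ^ 2 * (appellCoeff m n * α (m - 1) n * β m n) +
          (n : ℂ) ^ 2 * (appellCoeff m n * α m (n - 1) * β m n) -
          (m + n + 1 / 2) ^ 2 * appellCoeff m n * α m n * β m n) := by
    rw [appellProductCoeff_eq (M := M + 1) (N := N + 1) (by omega) (by omega),
      appellProductCoeff_eq (M := M + 1) (N := N + 1) (by omega) (by omega),
      Finset.mul_sum, Finset.mul_sum, ← Finset.sum_sub_distrib]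
    refine Finset.sum_congr rfl fun m _ => ?_
    rw [Finset.mul_sum, Finset.mul_sum, ← Finset.sum_sub_distrib]
    refine Finset.sum_congr rfl fun n _ => ?_
    linear_combination appellCoeff m n * β m n * shiftedBinomCoeff_hypergeometric m n i
  have s1 : ∑ m ∈ Finset.range (M + 1), ∑ n ∈ Finset.range (N + 1),
      (m : ℂ) ^ 2 * (appellCoeff m n * α (m - 1) n * β m n) =
      ∑ m ∈ Finset.range M, ∑ n ∈ Finset.range N,
        (m + n + 1 / 2) ^ 2 * appellCoeff m n * α m n * β (m + 1) n := by
    rw [Finset.sum_range_succ']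
    simp only [Nat.cast_zero, ne_eq, OfNat.ofNat_ne_zero, not_false_eq_true, zero_pow, zero_mul,
      Finset.sum_const_zero, add_zero]
    refine Finset.sum_congr rfl fun m _ => ?_
    rw [Finset.sum_range_succ, hβ _ _ le_rfl, mul_zero, mul_zero, add_zero]
    refine Finset.sum_congr rfl fun n _ => ?_
    rw [← appellCoeff_succ_left, Nat.add_sub_cancel]
    push_cast
    ring
  have s2 : ∑ m ∈ Finset.range (M + 1), ∑ n ∈ Finset.range (N + 1),
      (n : ℂ) ^ 2 * (appellCoeff m n * α m (n - 1) * β m n) =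
      ∑ m ∈ Finset.range M, ∑ n ∈ Finset.range N,
        (m + n + 1 / 2) ^ 2 * appellCoeff m n * α m n * β m (n + 1) := by
    rw [sum_range_eq_of_le (Nat.le_succ M)]
    · refine Finset.sum_congr rfl fun m _ => ?_
      rw [Finset.sum_range_succ']
      simp only [Nat.cast_zero, ne_eq, OfNat.ofNat_ne_zero, not_false_eq_true, zero_pow, zero_mul,
        add_zero]
      refine Finset.sum_congr rfl fun n _ => ?_
      rw [← appellCoeff_succ_right, Nat.add_sub_cancel]
      push_cast
      ring
    · intro m hm
      refine Finset.sum_eq_zero fun n _ => ?_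
      rw [hα _ _ hm]
      ring
  have s3 : ∑ m ∈ Finset.range (M + 1), ∑ n ∈ Finset.range (N + 1),
      (m + n + 1 / 2 : ℂ) ^ 2 * appellCoeff m n * α m n * β m n =
      ∑ m ∈ Finset.range M, ∑ n ∈ Finset.range N,
        (m + n + 1 / 2) ^ 2 * appellCoeff m n * α m n * β m n := by
    rw [sum_range_eq_of_le (Nat.le_succ M)]
    · refine Finset.sum_congr rfl fun m _ => ?_
      rw [Finset.sum_range_succ, hβ _ _ le_rfl, mul_zero, add_zero]
    · intro m hm
      refine Finset.sum_eq_zero fun n _ => ?_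
      rw [hα _ _ hm]
      ring
  rw [← sub_eq_zero, expand]
  simp_rw [Finset.sum_sub_distrib, Finset.sum_add_distrib]
  rw [s1, s2, s3]
  simp_rw [← Finset.sum_add_distrib, ← Finset.sum_sub_distrib]
  refine Finset.sum_eq_zero fun m _ => Finset.sum_eq_zero fun n _ => ?_
  linear_combination (m + n + 1 / 2 : ℂ) ^ 2 * appellCoeff m n * α m n *
    shiftedBinomCoeff_pascal m n j

/-- The recurrence in i is that of a_i²; at i = 0 only m = 0, n = j survives, leaving a_j². -/
lemma appellProductCoeff_eq_mul (i j : ℕ) :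
    appellProductCoeff i j = halfCoeff i ^ 2 * halfCoeff j ^ 2 := by
  induction i with
  | zero =>
    rw [appellProductCoeff, zero_add, Finset.sum_range_one, Finset.sum_range_succ,
      Finset.sum_eq_zero]
    · simp [shiftedBinomCoeff, appellCoeff, halfCoeff_zero]
    · intro n hn
      obtain ⟨p, rfl⟩ := Nat.exists_eq_add_of_lt (Finset.mem_range.mp hn)
      rw [add_assoc n, shiftedBinomCoeff_add]
      simp
  | succ i ih =>
    have h3 : (i + 1 : ℂ) ≠ 0 := by exact_mod_cast i.succ_ne_zero
    apply mul_left_cancel₀ (pow_ne_zero 2 h3)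
    rw [appellProductCoeff_succ, ih]
    have := halfCoeff_succ i
    linear_combination -((i + 1) * halfCoeff (i + 1) + (i + 1 / 2) * halfCoeff i) *
      halfCoeff j ^ 2 * this

lemma HasSum.mul_of_summable_norm {ι κ : Type*} {f : ι → ℂ} {g : κ → ℂ} {s t : ℂ}
    (hf : HasSum f s) (hg : HasSum g t) (hf' : Summable fun i => ‖f i‖)
    (hg' : Summable fun j => ‖g j‖) : HasSum (fun p : ι × κ => f p.1 * g p.2) (s * t) :=
  hf.mul hg (summable_mul_of_summable_norm hf' hg')

lemma hasSum_shiftedBinomCoeff_prod (X Y : ℂ) (m n : ℕ) :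
    HasSum (fun q : ℕ × ℕ => (shiftedBinomCoeff (-1 : ℂ) m n q.1 * X ^ q.1) *
        (shiftedBinomCoeff (-1 : ℂ) n m q.2 * Y ^ q.2))
      ((X * (1 - Y)) ^ m * (Y * (1 - X)) ^ n) := by
  have h := (hasSum_shiftedBinomCoeff (-1 : ℂ) X m n).mul_of_summable_norm
    (hasSum_shiftedBinomCoeff (-1 : ℂ) Y n m) (summable_norm_shiftedBinomCoeff X m n)
    (summable_norm_shiftedBinomCoeff Y n m)
  have e : (X * (1 - Y)) ^ m * (Y * (1 - X)) ^ n =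
      X ^ m * (1 + -1 * X) ^ n * (Y ^ n * (1 + -1 * Y) ^ m) := by
    rw [mul_pow, mul_pow]; ring
  rw [e]
  exact h

/-- The general term of the expansion of `F₄(1/2, 1/2; 1, 1; X (1 - Y), Y (1 - X))` in monomials
of `X` and `Y`. -/
noncomputable def appellTerm (X Y : ℂ) (q : (ℕ × ℕ) × (ℕ × ℕ)) : ℂ :=
  appellCoeff q.1.1 q.1.2 * ((shiftedBinomCoeff (-1 : ℂ) q.1.1 q.1.2 q.2.1 * X ^ q.2.1) *
    (shiftedBinomCoeff (-1 : ℂ) q.1.2 q.1.1 q.2.2 * Y ^ q.2.2))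

lemma hasSum_norm_appellTerm (X Y : ℂ) (p : ℕ × ℕ) :
    HasSum (fun q => ‖appellTerm X Y (p, q)‖) (‖appellCoeff p.1 p.2‖ *
      ((‖X‖ ^ p.1 * (1 + 1 * ‖X‖) ^ p.2) * (‖Y‖ ^ p.2 * (1 + 1 * ‖Y‖) ^ p.1))) := by
  have h1 := hasSum_shiftedBinomCoeff (1 : ℝ) ‖X‖ p.1 p.2
  have h2 := hasSum_shiftedBinomCoeff (1 : ℝ) ‖Y‖ p.2 p.1
  have hnn : ∀ (m n i : ℕ), 0 ≤ shiftedBinomCoeff (1 : ℝ) m n i := fun m n i => by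
    rw [← norm_shiftedBinomCoeff]; exact norm_nonneg _
  have h12 := (h1.mul h2 (h1.summable.mul_of_nonneg h2.summable
    (fun i => mul_nonneg (hnn _ _ _) (by positivity))
    (fun i => mul_nonneg (hnn _ _ _) (by positivity)))).mul_left ‖appellCoeff p.1 p.2‖
  have e : (fun q => ‖appellTerm X Y (p, q)‖) = fun q : ℕ × ℕ => ‖appellCoeff p.1 p.2‖ *
      (shiftedBinomCoeff (1 : ℝ) p.1 p.2 q.1 * ‖X‖ ^ q.1 *
        (shiftedBinomCoeff (1 : ℝ) p.2 p.1 q.2 * ‖Y‖ ^ q.2)) := by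
    funext q
    simp only [appellTerm, norm_mul, norm_pow, norm_shiftedBinomCoeff]
  rw [e]
  exact h12

lemma summable_appellTerm {X Y : ℂ} (hX : ‖X‖ < 1 / 8) (hY : ‖Y‖ < 1 / 8) :
    Summable (appellTerm X Y) := by
  apply Summable.of_norm
  rw [summable_prod_of_nonneg (fun _ => norm_nonneg _)]
  refine ⟨fun p => (hasSum_norm_appellTerm X Y p).summable, ?_⟩
  rw [funext fun p => (hasSum_norm_appellTerm X Y p).tsum_eq]
  -- The bound 1/8 gives ratio 4u(1+v) < 9/16; the 4 comes from `norm_appellCoeff_le`.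
  have hg : ∀ {u v : ℝ}, 0 ≤ u → 0 ≤ v → u < 1 / 8 → v < 1 / 8 →
      Summable fun n : ℕ => (4 * (u * (1 + 1 * v))) ^ n := fun hu hv hu' hv' =>
    summable_geometric_of_lt_one (by positivity) (by nlinarith)
  refine Summable.of_nonneg_of_le (fun p => by positivity) (fun p => ?_)
    ((hg (norm_nonneg X) (norm_nonneg Y) hX hY).mul_of_nonneg
      (hg (norm_nonneg Y) (norm_nonneg X) hY hX) (fun n => by positivity)
      (fun n => by positivity))
  calc _ ≤ (4 ^ p.1 * 4 ^ p.2) *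
      ((‖X‖ ^ p.1 * (1 + 1 * ‖X‖) ^ p.2) * (‖Y‖ ^ p.2 * (1 + 1 * ‖Y‖) ^ p.1)) := by
        gcongr
        exact norm_appellCoeff_le _ _
    _ = _ := by simp only [mul_pow]; ring

/-- Bailey's reduction of Appell's `F₄` to a product of two hypergeometric functions. -/
theorem hasSum_appell {X Y : ℂ} (hX : ‖X‖ < 1 / 8) (hY : ‖Y‖ < 1 / 8) :
    HasSum (fun p : ℕ × ℕ => appellCoeff p.1 p.2 * ((X * (1 - Y)) ^ p.1 * (Y * (1 - X)) ^ p.2))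
      (hypHalf X * hypHalf Y) := by
  obtain ⟨s, hs⟩ := summable_appellTerm hX hY
  have hrow : ∀ p : ℕ × ℕ, HasSum (fun q => appellTerm X Y (p, q))
      (appellCoeff p.1 p.2 * ((X * (1 - Y)) ^ p.1 * (Y * (1 - X)) ^ p.2)) := by
    intro p
    have h := (hasSum_shiftedBinomCoeff_prod X Y p.1 p.2).mul_left (appellCoeff p.1 p.2)
    simpa only [appellTerm] using h
  -- For a fixed monomial X^i Y^j only finitely many Appell terms contribute, and they add up to
  -- `appellProductCoeff`.
  have hcol : ∀ q : ℕ × ℕ, HasSum (fun p => appellTerm X Y (p, q))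
      ((halfCoeff q.1 ^ 2 * X ^ q.1) * (halfCoeff q.2 ^ 2 * Y ^ q.2)) := by
    intro q
    have : (halfCoeff q.1 ^ 2 * X ^ q.1) * (halfCoeff q.2 ^ 2 * Y ^ q.2) =
        ∑ p ∈ Finset.range (q.1 + 1) ×ˢ Finset.range (q.2 + 1), appellTerm X Y (p, q) := by
      rw [Finset.sum_product, mul_mul_mul_comm, ← appellProductCoeff_eq_mul, appellProductCoeff,
        Finset.sum_mul]
      refine Finset.sum_congr rfl fun m _ => ?_
      rw [Finset.sum_mul]
      refine Finset.sum_congr rfl fun n _ => ?_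
      simp only [appellTerm]
      ring
    rw [this]
    refine hasSum_sum_of_ne_finset_zero fun p hp => ?_
    simp only [Finset.mem_product, Finset.mem_range, not_and_or, not_lt] at hp
    simp only [appellTerm]
    rcases hp with hp | hp
    · rw [shiftedBinomCoeff_of_lt (i := q.1) _ (by omega)]; ring
    · rw [shiftedBinomCoeff_of_lt (i := q.2) _ (by omega)]; ring
  have hcols : HasSum (fun q : ℕ × ℕ => (halfCoeff q.1 ^ 2 * X ^ q.1) *
      (halfCoeff q.2 ^ 2 * Y ^ q.2)) s :=
    ((Equiv.prodComm (ℕ × ℕ) (ℕ × ℕ)).hasSum_iff.mpr hs).prod_fiberwise hcol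
  have hX1 : ‖X‖ < 1 := by linarith
  have hY1 : ‖Y‖ < 1 := by linarith
  have hprod := (hasSum_hypHalf hX1).mul_of_summable_norm (hasSum_hypHalf hY1)
    (summable_hypHalf_norm hX1) (summable_hypHalf_norm hY1)
  rw [← hcols.unique hprod]
  exact hs.prod_fiberwise hrow

/-! ### Generating function of squared binomial coefficients. -/

/-- Linearizes the square in n: expand one factor by Vandermonde over n = (n-k) + k, then use C(n,k)
C(n-k,i) = C(n,k+i) C(k+i,k). -/
lemma choose_sq_eq_sum (n k : ℕ) : n.choose k ^ 2 =
    ∑ i ∈ Finset.range (k + 1), (k + i).choose k * k.choose i * n.choose (k + i) := by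
  rcases lt_or_ge n k with h | h
  · rw [Nat.choose_eq_zero_of_lt h, Finset.sum_eq_zero]
    · simp
    · intro i _
      rw [Nat.choose_eq_zero_of_lt (show n < k + i by omega), mul_zero]
  · have hv := Nat.add_choose_eq (n - k) k k
    rw [Nat.sub_add_cancel h, Finset.Nat.sum_antidiagonal_eq_sum_range_succ_mk] at hv
    rw [sq]
    conv_lhs =>
      enter [2]
      rw [hv]
    rw [Finset.mul_sum]
    refine Finset.sum_congr rfl fun i hi => ?_
    have hi' : i ≤ k := Nat.lt_succ_iff.mp (Finset.mem_range.mp hi)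
    rw [Nat.choose_symm hi']
    rcases lt_or_ge n (k + i) with h' | h'
    · rw [Nat.choose_eq_zero_of_lt h', Nat.choose_eq_zero_of_lt (show n - k < i by omega)]
      simp
    · have := Nat.choose_mul (n := n) (Nat.le_add_right k i)
      rw [Nat.add_sub_cancel_left] at this
      rw [← mul_assoc, ← this]
      ring

/-- Expand C(k+i,k) = ∑_l C(k,l) C(i,l). Since C(k,i) C(i,l) = C(k,l) C(k-l,i-l), the sum over i
collapses to (x + (1-x))^{k-l} = 1. -/
lemma sum_choose_mul_pow_mul_one_sub_pow (x : ℂ) (k : ℕ) :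
    ∑ i ∈ Finset.range (k + 1), ((k + i).choose k : ℂ) * k.choose i * (x ^ i * (1 - x) ^ (k - i)) =
      ∑ j ∈ Finset.range (k + 1), (k.choose j : ℂ) ^ 2 * x ^ j := by
  have hv : ∀ i ∈ Finset.range (k + 1), ((k + i).choose k : ℂ) =
      ∑ l ∈ Finset.range (k + 1), (k.choose l : ℂ) * i.choose l := by
    intro i hi
    have := Nat.add_choose_eq i k k
    rw [Finset.Nat.sum_antidiagonal_eq_sum_range_succ_mk, add_comm i k] at this
    rw [this]
    push_cast
    refine Finset.sum_congr rfl fun l hl => ?_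
    rw [Nat.choose_symm (Nat.lt_succ_iff.mp (Finset.mem_range.mp hl)), mul_comm]
  have h1 : ∀ i ∈ Finset.range (k + 1),
      ((k + i).choose k : ℂ) * k.choose i * (x ^ i * (1 - x) ^ (k - i)) =
      ∑ l ∈ Finset.range (k + 1), (k.choose l : ℂ) *
        (k.choose i * i.choose l * (x ^ i * (1 - x) ^ (k - i))) := by
    intro i hi
    rw [hv i hi, Finset.sum_mul, Finset.sum_mul]
    exact Finset.sum_congr rfl fun l _ => by ring
  rw [Finset.sum_congr rfl h1, Finset.sum_comm]
  refine Finset.sum_congr rfl fun l hl => ?_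
  have hl' : l ≤ k := Nat.lt_succ_iff.mp (Finset.mem_range.mp hl)
  rw [← Finset.mul_sum, sq, mul_assoc]
  congr 1
  have hb := add_pow x (1 - x) (k - l)
  rw [add_sub_cancel, one_pow] at hb
  rw [show k + 1 = l + (k - l + 1) by omega, Finset.sum_range_add, Finset.sum_eq_zero, zero_add,
    ← mul_one ((k.choose l : ℂ) * x ^ l)]
  · conv_rhs => rw [hb, Finset.mul_sum]
    refine Finset.sum_congr rfl fun p hp => ?_
    have hp' : p ≤ k - l := Nat.lt_succ_iff.mp (Finset.mem_range.mp hp)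
    have := Nat.choose_mul (n := k) (Nat.le_add_right l p)
    rw [Nat.add_sub_cancel_left] at this
    have hcast : (k.choose (l + p) : ℂ) * (l + p).choose l = k.choose l * (k - l).choose p := by
      exact_mod_cast this
    rw [hcast, show k - (l + p) = k - l - p by omega, pow_add]
    ring
  · intro i hi
    rw [Nat.choose_eq_zero_of_lt (Finset.mem_range.mp hi)]
    simp

lemma hasSum_choose_mul_pow {x : ℂ} (hx : ‖x‖ < 1) (m : ℕ) :
    HasSum (fun n : ℕ => (n.choose m : ℂ) * x ^ n) (x ^ m / (1 - x) ^ (m + 1)) := by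
  have h := (hasSum_choose_mul_geometric_of_norm_lt_one m hx).mul_left (x ^ m)
  rw [← Function.Injective.hasSum_iff (add_left_injective m)]
  · convert! h using 1
    · funext n
      simp only [Function.comp_apply, pow_add]
      ring
    · ring
  · intro n hn
    have : n < m := by
      by_contra hlt
      exact hn ⟨n - m, by simp; omega⟩
    simp [Nat.choose_eq_zero_of_lt this]

/-- Euler's transformation for the generating function of the squared binomial coefficients. -/
lemma hasSum_choose_sq_mul_pow {x : ℂ} (hx : ‖x‖ < 1) (k : ℕ) :
    HasSum (fun n : ℕ => (n.choose k : ℂ) ^ 2 * x ^ n)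
      (x ^ k / (1 - x) ^ (2 * k + 1) *
        ∑ j ∈ Finset.range (k + 1), (k.choose j : ℂ) ^ 2 * x ^ j) := by
  have hne : 1 - x ≠ 0 := by
    intro h
    rw [← sub_eq_zero.mp h] at hx; simp at hx
  have h := hasSum_sum (s := Finset.range (k + 1)) fun i _ =>
    (hasSum_choose_mul_pow hx (k + i)).mul_left ((k + i).choose k * k.choose i : ℂ)
  convert! h using 1
  · funext n
    have : ((n.choose k ^ 2 : ℕ) : ℂ) = _ := congrArg Nat.cast (choose_sq_eq_sum n k)
    push_cast at this
    rw [this, Finset.sum_mul]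
    exact Finset.sum_congr rfl fun i _ => by ring
  · rw [← sum_choose_mul_pow_mul_one_sub_pow, Finset.mul_sum]
    refine Finset.sum_congr rfl fun i hi => ?_
    have hi' : i ≤ k := Nat.lt_succ_iff.mp (Finset.mem_range.mp hi)
    have : (1 - x) ^ (2 * k + 1) = (1 - x) ^ (k + i + 1) * (1 - x) ^ (k - i) := by
      rw [← pow_add]; congr 1; omega
    rw [this, pow_add x]
    field_simp

/-! ### Even moments of the walk. -/

lemma continuous_unitStep : Continuous unitStep := by
  unfold unitStep; fun_prop

lemma unitStep_add (x y : ℝ) : unitStep (x + y) = unitStep x * unitStep y := by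
  rw [unitStep, unitStep, unitStep, ← Complex.exp_add]; push_cast; ring_nf

lemma integral_unitStep_pow_mul_conj_pow (p q : ℕ) :
    ∫ θ in (0 : ℝ)..1, unitStep θ ^ p * (starRingEnd ℂ) (unitStep θ) ^ q =
      if p = q then 1 else 0 := by
  have key : ∀ θ : ℝ, unitStep θ ^ p * (starRingEnd ℂ) (unitStep θ) ^ q =
      Complex.exp ((2 * Real.pi * Complex.I * (p - q)) * θ) := by
    intro θ
    rw [unitStep, ← Complex.exp_conj, ← Complex.exp_nat_mul, ← Complex.exp_nat_mul,
      ← Complex.exp_add]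
    congr 1
    have h2 : (starRingEnd ℂ) 2 = 2 := Complex.conj_ofNat 2
    simp [h2]
    ring
  simp_rw [key]
  split_ifs with h
  · simp [h]
  · have hpq : (p - q : ℂ) ≠ 0 := by
      rw [sub_ne_zero]; exact_mod_cast h
    have hc : 2 * Real.pi * Complex.I * (p - q : ℂ) ≠ 0 :=
      mul_ne_zero Complex.two_pi_I_ne_zero hpq
    rw [integral_exp_mul_complex hc]
    have : Complex.exp (2 * Real.pi * Complex.I * (p - q : ℂ) * (1 : ℝ)) = 1 := by
      rw [Complex.exp_eq_one_iff]
      exact ⟨p - q, by push_cast; ring⟩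
    rw [this]
    simp

/-- The even moments of the distance to the origin of a unit step from `w`. -/
lemma integral_norm_unitStep_add_pow (w : ℂ) (n : ℕ) :
    ∫ θ in (0 : ℝ)..1, ‖unitStep θ + w‖ ^ (2 * n) =
      ∑ k ∈ Finset.range (n + 1), (n.choose k : ℝ) ^ 2 * ‖w‖ ^ (2 * k) := by
  have hnorm : ∀ z : ℂ, ∀ m : ℕ, ((‖z‖ ^ (2 * m) : ℝ) : ℂ) = z ^ m * (starRingEnd ℂ) z ^ m := by
    intro z m
    rw [← mul_pow, Complex.mul_conj, Complex.normSq_eq_norm_sq, pow_mul]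
    push_cast; rfl
  apply Complex.ofReal_injective
  rw [← intervalIntegral.integral_ofReal]
  push_cast
  -- Expand |z|^{2n} = z^n z̄^n doubly; integration keeps only i = j.
  have hexp : ∀ θ : ℝ, ((‖unitStep θ + w‖ : ℝ) : ℂ) ^ (2 * n) =
      ∑ i ∈ Finset.range (n + 1), ∑ j ∈ Finset.range (n + 1),
        (w ^ (n - i) * n.choose i * ((starRingEnd ℂ) w ^ (n - j) * n.choose j)) *
          (unitStep θ ^ i * (starRingEnd ℂ) (unitStep θ) ^ j) := by
    intro θ
    have := hnorm (unitStep θ + w) n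
    push_cast at this
    rw [this, map_add, add_pow, add_pow, Finset.sum_mul_sum]
    refine Finset.sum_congr rfl fun i _ => Finset.sum_congr rfl fun j _ => ?_
    ring
  simp_rw [hexp]
  have hcont : Continuous fun θ => (starRingEnd ℂ) (unitStep θ) :=
    Complex.continuous_conj.comp continuous_unitStep
  have hc := continuous_unitStep
  rw [intervalIntegral.integral_finsetSum
    (fun i _ => Continuous.intervalIntegrable (by fun_prop) _ _)]
  have hi : ∀ i ∈ Finset.range (n + 1), (∫ θ in (0 : ℝ)..1, ∑ j ∈ Finset.range (n + 1),
        (w ^ (n - i) * n.choose i * ((starRingEnd ℂ) w ^ (n - j) * n.choose j)) *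
          (unitStep θ ^ i * (starRingEnd ℂ) (unitStep θ) ^ j)) =
      (n.choose i : ℂ) ^ 2 * ((‖w‖ ^ (2 * (n - i)) : ℝ) : ℂ) := by
    intro i hi
    rw [intervalIntegral.integral_finsetSum
      (fun i _ => Continuous.intervalIntegrable (by fun_prop) _ _)]
    simp_rw [intervalIntegral.integral_const_mul, integral_unitStep_pow_mul_conj_pow]
    simp only [mul_ite, mul_one, mul_zero, Finset.sum_ite_eq, hi, if_true]
    rw [hnorm]; ring
  rw [Finset.sum_congr rfl hi, ← Finset.sum_range_reflect]
  refine Finset.sum_congr rfl fun k hk => ?_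
  have hk' : k ≤ n := Nat.lt_succ_iff.mp (Finset.mem_range.mp hk)
  rw [show n + 1 - 1 - k = n - k by omega, Nat.choose_symm hk', Nat.sub_sub_self hk']
  push_cast; rfl

lemma integral_norm_one_add_unitStep_pow (k : ℕ) :
    ∫ θ in (0 : ℝ)..1, ‖1 + unitStep θ‖ ^ (2 * k) = ((2 * k).choose k : ℝ) := by
  simp_rw [add_comm (1 : ℂ)]
  rw [integral_norm_unitStep_add_pow]
  simp only [norm_one, one_pow, mul_one]
  exact_mod_cast Nat.sum_range_choose_sq k

lemma intervalIntegral_swap_of_continuous {f : ℝ → ℝ → ℝ} (hf : Continuous (Function.uncurry f)) :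
    ∫ x in (0 : ℝ)..1, ∫ y in (0 : ℝ)..1, f x y = ∫ y in (0 : ℝ)..1, ∫ x in (0 : ℝ)..1, f x y := by
  apply MeasureTheory.intervalIntegral_intervalIntegral_swap
  exact (hf.continuousOn.integrableOn_compact
    (isCompact_uIcc.prod isCompact_uIcc)).mono_set
    (Set.prod_mono Set.uIoc_subset_uIcc Set.uIoc_subset_uIcc)

/-- The step in θ₁ is integrated first, with w = (1 + e^{2πiθ₂})(1 + e^{2πiθ₃}) fixed, which
requires moving it inside the other two integrals. -/
theorem walkMoment_two_mul (n : ℕ) : walkMoment (2 * (n : ℝ)) =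
    ∑ k ∈ Finset.range (n + 1), (n.choose k : ℝ) ^ 2 * ((2 * k).choose k : ℝ) ^ 2 := by
  have hc := continuous_unitStep
  have hint : ∀ a b c : ℝ, ‖1 + unitStep a + unitStep b + unitStep c + unitStep (b + c)‖ ^
      (2 * (n : ℝ)) = ‖unitStep a + (1 + unitStep b) * (1 + unitStep c)‖ ^ (2 * n) := by
    intro a b c
    rw [show (2 * (n : ℝ)) = ((2 * n : ℕ) : ℝ) by push_cast; rfl, Real.rpow_natCast, unitStep_add]
    congr 2
    ring
  unfold walkMoment
  simp_rw [hint]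
  rw [intervalIntegral_swap_of_continuous (f := fun a b => ∫ c in (0 : ℝ)..1,
    ‖unitStep a + (1 + unitStep b) * (1 + unitStep c)‖ ^ (2 * n))
    (intervalIntegral.continuous_parametric_intervalIntegral_of_continuous' (by
      unfold Function.uncurry; fun_prop) 0 1)]
  have hinner : ∀ b : ℝ, (∫ a in (0 : ℝ)..1, ∫ c in (0 : ℝ)..1,
      ‖unitStep a + (1 + unitStep b) * (1 + unitStep c)‖ ^ (2 * n)) =
      ∑ k ∈ Finset.range (n + 1),
        (n.choose k : ℝ) ^ 2 * ((2 * k).choose k : ℝ) * ‖1 + unitStep b‖ ^ (2 * k) := by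
    intro b
    rw [intervalIntegral_swap_of_continuous (by unfold Function.uncurry; fun_prop)]
    simp_rw [integral_norm_unitStep_add_pow, norm_mul, mul_pow]
    rw [intervalIntegral.integral_finsetSum
      (fun i _ => Continuous.intervalIntegrable (by fun_prop) _ _)]
    refine Finset.sum_congr rfl fun k _ => ?_
    rw [intervalIntegral.integral_const_mul, intervalIntegral.integral_const_mul,
      integral_norm_one_add_unitStep_pow]
    ring
  simp_rw [hinner]
  rw [intervalIntegral.integral_finsetSum
    (fun i _ => Continuous.intervalIntegrable (by fun_prop) _ _)]
  refine Finset.sum_congr rfl fun k _ => ?_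
  rw [intervalIntegral.integral_const_mul, integral_norm_one_add_unitStep_pow]
  ring

/-! ### Generating function of the twisted sums. -/

lemma twistedSum_eq (b : ℂ) (n : ℕ) : twistedSum b n =
    ∑ k ∈ Finset.range (n + 1), (n.choose k : ℂ) ^ 2 * (halfCoeff k ^ 2 * b ^ (2 * k)) := by
  refine Finset.sum_congr rfl fun k _ => ?_
  rw [halfCoeff, Nat.centralBinom, div_pow, div_pow, ← pow_mul, mul_comm k 2]
  ring

/-- Bounding one factor C(n,k) by 2^n makes row n a binomial expansion of (2(1+‖b‖²)‖x‖)^n. -/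
lemma summable_twistedSum_terms {b x : ℂ} (hx : 2 * (1 + ‖b‖ ^ 2) * ‖x‖ < 1) :
    Summable fun p : ℕ × ℕ =>
      (p.1.choose p.2 : ℂ) ^ 2 * (halfCoeff p.2 ^ 2 * b ^ (2 * p.2)) * x ^ p.1 := by
  have hle : ∀ n k : ℕ, ‖(n.choose k : ℂ) ^ 2 * (halfCoeff k ^ 2 * b ^ (2 * k)) * x ^ n‖ ≤
      (2 * ‖x‖) ^ n * ((‖b‖ ^ 2) ^ k * n.choose k) := by
    intro n k
    have h1 := norm_halfCoeff_le_one k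
    have h2 : (n.choose k : ℝ) ≤ 2 ^ n := by exact_mod_cast Nat.choose_le_two_pow _ _
    simp only [norm_mul, norm_pow, Complex.norm_natCast]
    calc _ ≤ (2 ^ n * (n.choose k : ℝ)) * (1 ^ 2 * ‖b‖ ^ (2 * k)) * ‖x‖ ^ n := by
          rw [sq (n.choose k : ℝ)]; gcongr
      _ = _ := by rw [pow_mul, mul_pow]; ring
  have hfin : ∀ n k : ℕ, k ∉ Finset.range (n + 1) →
      (‖b‖ ^ 2) ^ k * (n.choose k : ℝ) = 0 := by
    intro n k hk
    rw [Nat.choose_eq_zero_of_lt (by simpa using hk)]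
    simp
  have hrow : ∀ n : ℕ, HasSum (fun k => (2 * ‖x‖) ^ n * ((‖b‖ ^ 2) ^ k * (n.choose k : ℝ)))
      ((2 * (1 + ‖b‖ ^ 2) * ‖x‖) ^ n) := by
    intro n
    have h0 : HasSum (fun k => (‖b‖ ^ 2) ^ k * (n.choose k : ℝ)) _ :=
      hasSum_sum_of_ne_finset_zero (hfin n)
    have h := h0.mul_left ((2 * ‖x‖) ^ n)
    have e := add_pow (‖b‖ ^ 2) 1 n
    simp only [one_pow, mul_one] at e
    rw [← e, ← mul_pow] at h
    convert! h using 2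
    ring
  refine Summable.of_norm_bounded
    (g := fun p : ℕ × ℕ => (2 * ‖x‖) ^ p.1 * ((‖b‖ ^ 2) ^ p.2 * (p.1.choose p.2 : ℝ))) ?_
    fun p => hle p.1 p.2
  rw [summable_prod_of_nonneg (fun p => by positivity)]
  refine ⟨fun n => (hrow n).summable, ?_⟩
  rw [funext fun n => (hrow n).tsum_eq]
  exact summable_geometric_of_lt_one (by positivity) hx

/-- The generating function of the twisted sums, in Bailey's parametrization. -/
theorem hasSum_twistedSum {b x X Y : ℂ} (hx : 2 * (1 + ‖b‖ ^ 2) * ‖x‖ < 1)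
    (hX : ‖X‖ < 1 / 8) (hY : ‖Y‖ < 1 / 8) (h1 : X * (1 - Y) = b ^ 2 * x / (1 - x) ^ 2)
    (h2 : Y * (1 - X) = b ^ 2 * x / (1 - x) ^ 2 * x) :
    HasSum (fun n : ℕ => x ^ n * twistedSum b n) ((1 - x)⁻¹ * (hypHalf X * hypHalf Y)) := by
  have hx1 : ‖x‖ < 1 := by nlinarith [norm_nonneg x, sq_nonneg ‖b‖]
  obtain ⟨s, hs⟩ := summable_twistedSum_terms hx
  have hrow : ∀ n : ℕ, HasSum
      (fun k => (n.choose k : ℂ) ^ 2 * (halfCoeff k ^ 2 * b ^ (2 * k)) * x ^ n)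
      (x ^ n * twistedSum b n) := by
    intro n
    have e : x ^ n * twistedSum b n = ∑ k ∈ Finset.range (n + 1),
        (n.choose k : ℂ) ^ 2 * (halfCoeff k ^ 2 * b ^ (2 * k)) * x ^ n := by
      rw [twistedSum_eq, mul_comm, Finset.sum_mul]
    rw [e]
    refine hasSum_sum_of_ne_finset_zero fun k hk => ?_
    rw [Nat.choose_eq_zero_of_lt (by simpa using hk)]
    simp
  -- Column k is the degree-k homogeneous part of the Appell series. The second index carries the
  -- power of x, hence the reflection j ↦ k - j.
  have hcol : ∀ k : ℕ, HasSum
      (fun n => (n.choose k : ℂ) ^ 2 * (halfCoeff k ^ 2 * b ^ (2 * k)) * x ^ n)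
      ((1 - x)⁻¹ * ∑ p ∈ Finset.HasAntidiagonal.antidiagonal k,
        appellCoeff p.1 p.2 * ((X * (1 - Y)) ^ p.1 * (Y * (1 - X)) ^ p.2)) := by
    intro k
    have h := (hasSum_choose_sq_mul_pow hx1 k).mul_left (halfCoeff k ^ 2 * b ^ (2 * k))
    have e : (1 - x)⁻¹ * ∑ p ∈ Finset.HasAntidiagonal.antidiagonal k,
        appellCoeff p.1 p.2 * ((X * (1 - Y)) ^ p.1 * (Y * (1 - X)) ^ p.2) =
        halfCoeff k ^ 2 * b ^ (2 * k) * (x ^ k / (1 - x) ^ (2 * k + 1) *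
          ∑ j ∈ Finset.range (k + 1), (k.choose j : ℂ) ^ 2 * x ^ j) := by
      rw [← Finset.sum_range_reflect (fun j => (k.choose j : ℂ) ^ 2 * x ^ j),
        Finset.Nat.sum_antidiagonal_eq_sum_range_succ_mk, Finset.mul_sum, Finset.mul_sum,
        Finset.mul_sum]
      refine Finset.sum_congr rfl fun j hj => ?_
      have hj' : j ≤ k := Nat.lt_succ_iff.mp (Finset.mem_range.mp hj)
      have e2 : (b ^ 2 * x / (1 - x) ^ 2) ^ j * (b ^ 2 * x / (1 - x) ^ 2) ^ (k - j) =
          b ^ (2 * k) * x ^ k / (1 - x) ^ (2 * k) := by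
        rw [← pow_add, Nat.add_sub_cancel' hj', div_pow, mul_pow, pow_mul, pow_mul]
      rw [show k + 1 - 1 - j = k - j by omega, Nat.choose_symm hj', h1, h2, mul_pow _ x,
        ← mul_assoc ((b ^ 2 * x / (1 - x) ^ 2) ^ j), e2, appellCoeff]
      simp only [Nat.add_sub_cancel' hj']
      rw [pow_succ (1 - x)]
      simp only [div_eq_mul_inv, mul_inv]
      ring
    rw [e]
    have e3 : (fun n : ℕ => (n.choose k : ℂ) ^ 2 * (halfCoeff k ^ 2 * b ^ (2 * k)) * x ^ n) =
        fun n : ℕ => halfCoeff k ^ 2 * b ^ (2 * k) * ((n.choose k : ℂ) ^ 2 * x ^ n) := by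
      funext n; ring
    rw [e3]
    exact h
  have hcols := ((Equiv.prodComm ℕ ℕ).hasSum_iff.mpr hs).prod_fiberwise hcol
  have hA := (hasSum_appell hX hY).sum_antidiagonal.mul_left (1 - x)⁻¹
  rw [← hcols.unique hA]
  exact hs.prod_fiberwise hrow

/-! ### Parametrization by t near the origin. -/

/-- The generating function of the twisted sums, near the origin. -/
theorem eventually_hasSum_twistedSum {b : ℂ} (hb : b ≠ 0) : ∀ᶠ t : ℂ in 𝓝 0,
    b + t ≠ 0 ∧ 1 + b * t ≠ 0 ∧ 1 + b * t + t ^ 2 ≠ 0 ∧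
    HasSum (fun n : ℕ => (t / ((b + t) * (1 + b * t))) ^ n * twistedSum b n)
      ((b + t) * (1 + b * t) / (b * (1 + b * t + t ^ 2)) *
        (hypHalf (t * (b + t) / (1 + b * t + t ^ 2)) *
          hypHalf (t ^ 2 / (1 + b * t + t ^ 2)))) := by
  have c1 : ContinuousAt (fun t : ℂ => b + t) 0 := by fun_prop
  have c2 : ContinuousAt (fun t : ℂ => 1 + b * t) 0 := by fun_prop
  have c3 : ContinuousAt (fun t : ℂ => 1 + b * t + t ^ 2) 0 := by fun_prop
  have cx : ContinuousAt (fun t : ℂ => 2 * (1 + ‖b‖ ^ 2) * ‖t / ((b + t) * (1 + b * t))‖) 0 := by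
    have : ContinuousAt (fun t : ℂ => t / ((b + t) * (1 + b * t))) 0 :=
      continuousAt_id.div (c1.mul c2) (by simpa using hb)
    fun_prop
  have cX : ContinuousAt (fun t : ℂ => ‖t * (b + t) / (1 + b * t + t ^ 2)‖) 0 :=
    ((continuousAt_id.mul c1).div c3 (by simp)).norm
  have cY : ContinuousAt (fun t : ℂ => ‖t ^ 2 / (1 + b * t + t ^ 2)‖) 0 :=
    ((continuousAt_id.pow 2).div c3 (by simp)).norm
  filter_upwards [c1.eventually_ne (y := 0) (by simpa using hb),
    c2.eventually_ne (y := 0) (by simp),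
    c3.eventually_ne (y := 0) (by simp), cx.tendsto.eventually_lt_const (u := 1) (by simp),
    cX.tendsto.eventually_lt_const (u := 1 / 8) (by simp), cY.tendsto.eventually_lt_const (u := 1 / 8) (by simp)]
    with t h1 h2 h3 hx hX hY
  refine ⟨h1, h2, h3, ?_⟩
  have h2' : 1 + t * b ≠ 0 := by rwa [mul_comm]
  have h3' : 1 + t * b + t ^ 2 ≠ 0 := by rwa [mul_comm t]
  have hsub : 1 - t / ((b + t) * (1 + b * t)) =
      b * (1 + b * t + t ^ 2) / ((b + t) * (1 + b * t)) := by
    field_simp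
    ring
  -- Here 1 - X = 1/D and 1 - Y = (1+bt)/D with D = 1+bt+t².
  have h := hasSum_twistedSum hx hX hY
    (by rw [hsub]; field_simp; ring) (by rw [hsub]; field_simp; ring)
  rwa [hsub, inv_div] at h

/-- Both sides have the same square, so they agree up to sign. Their sum is continuous at t = 0 with
value 2, which rules out the minus sign nearby. -/
lemma eventually_cpow_half_mul (b : ℂ) : ∀ᶠ t : ℂ in 𝓝 0,
    (1 + b * t + t ^ 2) ^ (1 / 2 : ℂ) * ((1 + b * t + t ^ 2) / (1 + b * t)) ^ (1 / 2 : ℂ) *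
      (1 + b * t) ^ (1 / 2 : ℂ) = 1 + b * t + t ^ 2 := by
  have c2 : ContinuousAt (fun t : ℂ => 1 + b * t) 0 := by fun_prop
  have c3 : ContinuousAt (fun t : ℂ => 1 + b * t + t ^ 2) 0 := by fun_prop
  have c4 : ContinuousAt (fun t : ℂ => (1 + b * t + t ^ 2) / (1 + b * t)) 0 :=
    c3.div c2 (by simp)
  have c : ContinuousAt (fun t : ℂ => (1 + b * t + t ^ 2) ^ (1 / 2 : ℂ) *
      ((1 + b * t + t ^ 2) / (1 + b * t)) ^ (1 / 2 : ℂ) * (1 + b * t) ^ (1 / 2 : ℂ) +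
      (1 + b * t + t ^ 2)) 0 :=
    (((c3.cpow continuousAt_const (by simp)).mul (c4.cpow continuousAt_const (by simp))).mul
      (c2.cpow continuousAt_const (by simp))).add c3
  filter_upwards [c.eventually_ne (y := 0) (by norm_num), c2.eventually_ne (y := 0) (by simp)]
    with t hne h2
  have hsq : ∀ z : ℂ, (z ^ (1 / 2 : ℂ)) ^ 2 = z := fun z => by
    rw [one_div]; exact Complex.cpow_nat_inv_pow z two_ne_zero
  have hfac : ∀ u v w D E : ℂ, u ^ 2 = D → v ^ 2 = D / E → w ^ 2 = E → E ≠ 0 →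
      u * v * w + D ≠ 0 → u * v * w = D := by
    intro u v w D E hu hv hw hE hD
    have h : (u * v * w - D) * (u * v * w + D) = 0 := by
      have : (u * v * w) ^ 2 = D ^ 2 := by
        rw [mul_pow, mul_pow, hu, hv, hw]; field_simp
      linear_combination this
    rcases mul_eq_zero.mp h with h | h
    · linear_combination h
    · exact absurd h hD
  exact hfac _ _ _ _ _ (hsq _) (hsq _) (hsq _) h2 hne

/-- Pfaff at z = -t(b+t) and at z = -t²/(1+bt), where 1 - z is D and D/(1+bt) respectively, D =
1+bt+t²; `eventually_cpow_half_mul` merges the square roots. -/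
theorem eventually_hypHalf_mul_hypHalf (b : ℂ) : ∀ᶠ t : ℂ in 𝓝 0,
    hypHalf (-t * (b + t)) * (1 / (1 + b * t) ^ (1 / 2 : ℂ) * hypHalf (-(t ^ 2 / (1 + b * t)))) =
      1 / (1 + b * t + t ^ 2) * hypHalf (t * (b + t) / (1 + b * t + t ^ 2)) *
        hypHalf (t ^ 2 / (1 + b * t + t ^ 2)) := by
  have c2 : ContinuousAt (fun t : ℂ => 1 + b * t) 0 := by fun_prop
  have c3 : ContinuousAt (fun t : ℂ => 1 + b * t + t ^ 2) 0 := by fun_prop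
  have cz : ContinuousAt (fun t : ℂ => ‖-t * (b + t)‖) 0 := by fun_prop
  have cw : ContinuousAt (fun t : ℂ => ‖-(t ^ 2 / (1 + b * t))‖) 0 :=
    (((continuousAt_id.pow 2).div c2 (by simp)).neg).norm
  filter_upwards [eventually_cpow_half_mul b, c2.eventually_ne (y := 0) (by simp),
    c3.eventually_ne (y := 0) (by simp), cz.tendsto.eventually_lt_const (u := 1 / 3) (by simp),
    cw.tendsto.eventually_lt_const (u := 1 / 3) (by simp)] with t hpow h2 h3 hz hw
  have h2' : 1 + t * b ≠ 0 := by rwa [mul_comm]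
  have h3' : 1 + t * b + t ^ 2 ≠ 0 := by rwa [mul_comm t]
  have e1 := hypHalf_pfaff hz
  have e2 := hypHalf_pfaff hw
  have d1 : 1 - -t * (b + t) = 1 + b * t + t ^ 2 := by ring
  have d2 : 1 - -(t ^ 2 / (1 + b * t)) = (1 + b * t + t ^ 2) / (1 + b * t) := by
    field_simp
    ring
  have q1 : -t * (b + t) / (-t * (b + t) - 1) = t * (b + t) / (1 + b * t + t ^ 2) := by
    rw [← neg_sub, d1]; field_simp
  have q2 : -(t ^ 2 / (1 + b * t)) / (-(t ^ 2 / (1 + b * t)) - 1) =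
      t ^ 2 / (1 + b * t + t ^ 2) := by
    rw [← neg_sub, d2]; field_simp
  rw [q1, d1] at e1
  rw [q2, d2] at e2
  rw [e1, e2]
  have hE : (1 + b * t) ^ (1 / 2 : ℂ) ≠ 0 := by
    simp [Complex.cpow_eq_zero_iff, h2]
  generalize (1 + b * t) ^ (1 / 2 : ℂ) = w at *
  generalize (1 + b * t + t ^ 2) ^ (1 / 2 : ℂ) = u at *
  generalize ((1 + b * t + t ^ 2) / (1 + b * t)) ^ (1 / 2 : ℂ) = v at *
  generalize hypHalf (-t * (b + t)) = F at *
  generalize hypHalf (-(t ^ 2 / (1 + b * t))) = G at *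
  generalize 1 + b * t + t ^ 2 = D at *
  field_simp
  linear_combination -(F * G) * hpow

theorem theorem1 :
    -- the even moments
    (∀ n : ℕ, walkMoment (2 * (n : ℝ)) =
      ∑ k ∈ Finset.range (n + 1), (n.choose k : ℝ) ^ 2 * ((2 * k).choose k : ℝ) ^ 2) ∧
    -- their generating function
    (∀ᶠ t : ℂ in 𝓝 0,
      HasSum (fun n : ℕ => (walkMoment (2 * (n : ℝ)) : ℂ) * (t / ((4 + t) * (1 + 4 * t))) ^ n)
        ((4 + t) * (1 + 4 * t) / (4 * (1 + 4 * t + t ^ 2)) *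
          hypHalf (t * (4 + t) / (1 + 4 * t + t ^ 2)) *
          hypHalf (t ^ 2 / (1 + 4 * t + t ^ 2)))) ∧
    -- the generalization with a parameter
    (∀ b : ℂ, b ≠ 0 → ∀ᶠ t : ℂ in 𝓝 0,
      Summable (fun n : ℕ => (t / ((b + t) * (1 + b * t))) ^ n * twistedSum b n) ∧
      b / ((b + t) * (1 + b * t)) *
          ∑' n : ℕ, (t / ((b + t) * (1 + b * t))) ^ n * twistedSum b n =
        hypHalf (-t * (b + t)) *
          (1 / (1 + b * t) ^ (1 / 2 : ℂ) * hypHalf (-(t ^ 2 / (1 + b * t)))) ∧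
      hypHalf (-t * (b + t)) *
          (1 / (1 + b * t) ^ (1 / 2 : ℂ) * hypHalf (-(t ^ 2 / (1 + b * t)))) =
        1 / (1 + b * t + t ^ 2) *
          hypHalf (t * (b + t) / (1 + b * t + t ^ 2)) *
          hypHalf (t ^ 2 / (1 + b * t + t ^ 2))) := by
  refine ⟨walkMoment_two_mul, ?_, fun b hb => ?_⟩
  -- At b = 4 the twist (b/4)^{2k} is 1, so the twisted sum is the moment.
  · filter_upwards [eventually_hasSum_twistedSum (b := 4) (by norm_num)] with t ⟨_, _, _, h⟩
    convert! h using 1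
    · funext n
      rw [walkMoment_two_mul, twistedSum, div_self (by norm_num)]
      push_cast
      simp only [one_pow, mul_one]
      ring
    · ring
  · filter_upwards [eventually_hasSum_twistedSum hb, eventually_hypHalf_mul_hypHalf b]
      with t ⟨h1, h2, h3, h⟩ hprod
    refine ⟨h.summable, ?_, hprod⟩
    rw [hprod, h.tsum_eq]
    field_simp
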